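/- Throughout, a compactum is a compact Hausdorff space, $\mathbf{Comp}$ is the category of compacta and continuous maps, and $F:\mathbf{Comp}\to\mathbf{Comp}$ is a (covariant) functor. A map $f:X\to Y$ is skeletal if $f^{-1}(A)$ is nowhere dense in $X$ for each nowhere dense $A\subset Y$. An inverse spectrum $\{X_\alpha,\pi_\alpha^\beta,\Sigma\}$ over a partially ordered set $\Sigma$ is an $\omega$-spectrum if each $X_\alpha$ has countable weight, each countable subset of $\Sigma$ has a least upper bound in $\Sigma$, and for each nonempty countable directed $\Sigma'\subset\Sigma$ with $\gamma=\sup\Sigma'$ the canonical map $X_\gamma\to\lim\{X_\alpha,\pi_\alpha^\beta,\Sigma'\}$ is a homeomorphism. A compactum is skeletally generated if it is homeomorphic to the limit of an $\omega$-spectrum consisting of metrizable compacta $X_\alpha$ and surjective skeletal bonding maps $\pi_\alpha^\beta:X_\beta\to X_\alpha$, $\alpha\le\beta$. A commutative square of compacta with maps $\tilde f:\tilde X\to\tilde Y$, $p_X:\tilde X\to X$, $p_Y:\tilde Y\to Y$, $f:X\to Y$ (so $p_Y\circ\tilde f=f\circ p_X$) is bicommutative if $\tilde f(p_X^{-1}(x))=p_Y^{-1}(f(x))$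 for all $x\in X$. A functor $F$ is a 1-mecw functor if (i) $F$ sends injective maps to injective maps; (ii) $F$ sends surjective maps to surjective maps; (iii) $F$ is continuous, that is, it preserves limits of inverse spectra of compacta over nonempty directed partially ordered sets; (iv) $F$ preserves finite 1-preimages, that is, $F$ preserves the bicommutativity of squares as above with $f,\tilde f$ injective, $p_X$ bijective and $X$ finite; (v) $w(FX)\le w(X)$ for each infinite compactum $X$, where $w$ denotes the weight (the smallest cardinality of a base of the topology). A functor $F$ is normal if it satisfies (i), (ii), (iii), (v), preserves intersections of families of closed subspaces, preserves the empty set and the singleton, and preserves preimages, that is, preserves the bicommutativity of squares as above with $f,\tilde f$ injective. **Theorem 1.6.** If $F:\mathbf{Comp}\to\mathbf{Comp}$ is a 1-mecw functor and $X$ is a skeletally generated compactum, then $FX$ is skeletally generated. Moreover, every normal functor is a 1-mecw functor (so every normal functor sends skeletally generated compacta to skeletally generated compacta). -/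

import Mathlib

open CategoryTheory CategoryTheory.Limits Opposite TopologicalSpace

universe u

/-! ### Skeletal maps and the weight of a space -/

/-- A map is skeletal if preimages of nowhere dense sets are nowhere dense. -/
def IsSkeletalMap {X Y : Type*} [TopologicalSpace X] [TopologicalSpace Y] (f : X → Y) : Prop :=
  ∀ A : Set Y, IsNowhereDense A → IsNowhereDense (f ⁻¹' A)

/-- The weight of a space: the smallest cardinality of a base of its topology. -/
noncomputable def topWeight (X : Type u) [TopologicalSpace X] : Cardinal.{u} :=
  sInf {κ | ∃ B : Set (Set X), IsTopologicalBasis B ∧ Cardinal.mk B = κ}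

/-! ### Inverse spectra

An inverse spectrum of compacta indexed by a partially ordered set `I` is a functor
`S : Iᵒᵖ ⥤ CompHaus`. -/

namespace InverseSpectrum

variable {I : Type u} [PartialOrder I]

/-- The bonding map `X_β → X_α` for `α ≤ β`. -/
def bond (S : Iᵒᵖ ⥤ CompHaus.{u}) {α β : I} (h : α ≤ β) : S.obj (op β) ⟶ S.obj (op α) :=
  S.map (homOfLE h).op

/-- The restriction of a spectrum to a subset of the index set. -/
def restrict (S : Iᵒᵖ ⥤ CompHaus.{u}) (T : Set I) : (↥T)ᵒᵖ ⥤ CompHaus.{u} :=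
  (Subtype.mono_coe (· ∈ T)).functor.op ⋙ S

/-- For an upper bound `γ` of `T`, the space `X_γ` with the bonding maps `X_γ → X_α`, `α ∈ T`,
as a cone over the restricted spectrum. -/
def coneAt (S : Iᵒᵖ ⥤ CompHaus.{u}) (T : Set I) {γ : I} (hγ : γ ∈ upperBounds T) :
    Cone (restrict S T) where
  pt := S.obj (op γ)
  π :=
    { app := fun α => bond S (hγ α.unop.2)
      naturality := by
        intro α β f
        simp only [Functor.const_obj_obj, Functor.const_obj_map, Category.id_comp, bond, restrict,
          Functor.comp_map, ← S.map_comp]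
        rfl }

/-- An `ω`-spectrum: all spaces have countable weight, every countable subset of the index set
has a least upper bound (so the index set is nonempty and directed), and for every countable
directed subset `T` with supremum `γ` the space `X_γ` is, through the bonding maps, the limit of
the spectrum restricted to `T`. -/
structure IsOmegaSpectrum (S : Iᵒᵖ ⥤ CompHaus.{u}) : Prop where
  countable_weight : ∀ α : I, SecondCountableTopology (S.obj (op α))
  omega_complete : ∀ T : Set I, T.Countable → ∃ γ : I, IsLUB T γ
  omega_continuous : ∀ (T : Set I) (γ : I), T.Countable → T.Nonempty → DirectedOn (· ≤ ·) T →
    ∀ hγ : IsLUB T γ, Nonempty (IsLimit (coneAt S T hγ.1))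

end InverseSpectrum

/-- A compactum is skeletally generated if it is homeomorphic to the limit of a continuous
`ω`-spectrum of metrizable compacta with surjective skeletal bonding maps. -/
def SkeletallyGenerated (X : CompHaus.{u}) : Prop :=
  ∃ (I : Type u) (_ : PartialOrder I) (S : Iᵒᵖ ⥤ CompHaus.{u}) (c : Cone S),
    InverseSpectrum.IsOmegaSpectrum S ∧
    (∀ α : I, MetrizableSpace (S.obj (op α))) ∧
    (∀ (α β : I) (h : α ≤ β), Function.Surjective (InverseSpectrum.bond S h) ∧
      IsSkeletalMap (InverseSpectrum.bond S h)) ∧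
    Nonempty (IsLimit c) ∧ Nonempty (c.pt ≃ₜ X)

/-! ### Properties of functors `Comp → Comp` -/

namespace CompFunctor

/-- `F` sends injective maps to injective maps. -/
def Monomorphic (F : CompHaus.{u} ⥤ CompHaus.{u}) : Prop :=
  ∀ ⦃X Y : CompHaus.{u}⦄ (f : X ⟶ Y), Function.Injective f → Function.Injective (F.map f)

/-- `F` sends surjective maps to surjective maps. -/
def Epimorphic (F : CompHaus.{u} ⥤ CompHaus.{u}) : Prop :=
  ∀ ⦃X Y : CompHaus.{u}⦄ (f : X ⟶ Y), Function.Surjective f → Function.Surjective (F.map f)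

/-- `F` preserves limits of inverse spectra over (nonempty) directed partially ordered sets. -/
def ContinuousFunctor (F : CompHaus.{u} ⥤ CompHaus.{u}) : Prop :=
  ∀ (I : Type u) [PartialOrder I] [Nonempty I] [IsDirectedOrder I], PreservesLimitsOfShape Iᵒᵖ F

/-- `w(FX) ≤ w(X)` for all infinite compacta `X`. -/
def WeightPreserving (F : CompHaus.{u} ⥤ CompHaus.{u}) : Prop :=
  ∀ X : CompHaus.{u}, Infinite X → topWeight (F.obj X) ≤ topWeight X

/-- A commutative square
```
  X' --f'--> Y'
  |          |
  pX         pY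
  v          v
  X  --f-->  Y
```
is bicommutative if `f' (pX⁻¹ x) = pY⁻¹ (f x)` for all `x ∈ X`. -/
structure Bicommutative {X' Y' X Y : CompHaus.{u}}
    (f' : X' ⟶ Y') (pX : X' ⟶ X) (pY : Y' ⟶ Y) (f : X ⟶ Y) : Prop where
  comm : CommSq f' pX pY f
  image_fiber : ∀ x : X, f' '' (pX ⁻¹' {x}) = pY ⁻¹' {f x}

/-- `F` preserves the bicommutativity of squares with injective horizontal maps. -/
def PreservesPreimages (F : CompHaus.{u} ⥤ CompHaus.{u}) : Prop :=
  ∀ ⦃X' Y' X Y : CompHaus.{u}⦄ (f' : X' ⟶ Y') (pX : X' ⟶ X) (pY : Y' ⟶ Y) (f : X ⟶ Y),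
    Function.Injective f → Function.Injective f' → Bicommutative f' pX pY f →
    Bicommutative (F.map f') (F.map pX) (F.map pY) (F.map f)

/-- `F` preserves the bicommutativity of squares with injective horizontal maps, bijective `pX`
and finite `X`. -/
def PreservesFiniteOnePreimages (F : CompHaus.{u} ⥤ CompHaus.{u}) : Prop :=
  ∀ ⦃X' Y' X Y : CompHaus.{u}⦄ (f' : X' ⟶ Y') (pX : X' ⟶ X) (pY : Y' ⟶ Y) (f : X ⟶ Y),
    Finite X → Function.Injective f → Function.Injective f' → Function.Bijective pX →
    Bicommutative f' pX pY f →
    Bicommutative (F.map f') (F.map pX) (F.map pY) (F.map f)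

/-- A closed subspace of a compactum, as a compactum. -/
def closedSub {X : CompHaus.{u}} (A : Closeds X) : CompHaus.{u} :=
  haveI : CompactSpace (A : Set X) := isCompact_iff_compactSpace.mp A.isClosed.isCompact
  CompHaus.of (A : Set X)

/-- The inclusion of a closed subspace. -/
def closedIncl {X : CompHaus.{u}} (A : Closeds X) : closedSub A ⟶ X :=
  haveI : CompactSpace (A : Set X) := isCompact_iff_compactSpace.mp A.isClosed.isCompact
  CompHausLike.ofHom _ (⟨Subtype.val, continuous_subtype_val⟩ : C((A : Set X), X))

/-- For closed `A ⊆ X`, the subset `FA` of `FX`: the image of `F` applied to the inclusion. -/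
def sub (F : CompHaus.{u} ⥤ CompHaus.{u}) {X : CompHaus.{u}} (A : Closeds X) : Set (F.obj X) :=
  Set.range (F.map (closedIncl A))

/-- `F(⋂ A) = ⋂ FA` for all families of closed subsets of a compactum. -/
def PreservesIntersections (F : CompHaus.{u} ⥤ CompHaus.{u}) : Prop :=
  ∀ (X : CompHaus.{u}) (𝒜 : Set (Closeds X)), sub F (sInf 𝒜) = ⋂ A ∈ 𝒜, sub F A

/-- `F` preserves the empty set. -/
def PreservesEmpty (F : CompHaus.{u} ⥤ CompHaus.{u}) : Prop :=
  ∀ X : CompHaus.{u}, IsEmpty X → IsEmpty (F.obj X)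

/-- `F` preserves the singleton. -/
def PreservesSingleton (F : CompHaus.{u} ⥤ CompHaus.{u}) : Prop :=
  ∀ X : CompHaus.{u}, Nonempty (Unique X) → Nonempty (Unique (F.obj X))

/-- A 1-mecw functor: monomorphic, epimorphic, continuous, preserving finite 1-preimages and the
weight of infinite compacta. -/
structure IsOneMecw (F : CompHaus.{u} ⥤ CompHaus.{u}) : Prop where
  monomorphic : Monomorphic F
  epimorphic : Epimorphic F
  continuous : ContinuousFunctor F
  finiteOnePreimages : PreservesFiniteOnePreimages F
  weight : WeightPreserving F

/-- A normal functor: monomorphic, epimorphic, continuous, preserving intersections, the empty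
set, the singleton, the weight of infinite compacta, and preimages. -/
structure IsNormal (F : CompHaus.{u} ⥤ CompHaus.{u}) : Prop where
  monomorphic : Monomorphic F
  epimorphic : Epimorphic F
  continuous : ContinuousFunctor F
  intersections : PreservesIntersections F
  empty : PreservesEmpty F
  singleton : PreservesSingleton F
  weight : WeightPreserving F
  preimages : PreservesPreimages F

end CompFunctor

/-! The main point is that `F.map f` is skeletal for a skeletal surjection `f : X → Y` of metrizable
compacta whose fibers over isolated points of `Y` are singletons (`IsOneMecw.isSkeletalMap_map`). It
suffices that the image of every nonempty open `U ⊆ FX` has interior. Cover `X` by a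
zero-dimensional `Z`, irreducibly. As `Z` is a limit of finite quotients and `F` is continuous, `U`
contains elements supported on finite sets, and the support may be moved within prescribed open
sets. Move it to a finite set on which `f` is injective and at whose points `f` is open. Some closed
`T ⊆ X` then contains this support, maps onto `Y` and meets the fibers through the support only in
the support. By preservation of finite 1-preimages, `F(f|T)` has a one-point fiber at the chosen
element, and a surjective closed map sends neighborhoods of such a point to sets with interior.

Bonding maps of a given spectrum need not be injective over isolated points. This is repaired by
reindexing along suprema of countable index sets closed under splitting isolated points
(`IsOmegaSpectrum.eq_of_bond_eq`); applying `F` to the new spectrum gives one for `FX`. A normal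
functor is 1-mecw because finite 1-preimages are special preimages. -/

/-! ### Skeletal maps -/

section Topology

variable {X Y : Type*} [TopologicalSpace X] [TopologicalSpace Y] {f : X → Y}

open Topology Filter

theorem isSkeletalMap_of_nonempty_interior_image (hf : Continuous f)
    (h : ∀ U : Set X, IsOpen U → U.Nonempty → (interior (f '' U)).Nonempty) :
    IsSkeletalMap f := by
  intro A hA
  rw [IsNowhereDense, ← Set.not_nonempty_iff_eq_empty]
  intro hne
  obtain ⟨y, hy⟩ := h _ isOpen_interior hne
  have hsub : f '' interior (closure (f ⁻¹' A)) ⊆ closure A := by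
    rintro _ ⟨x, hx, rfl⟩
    exact closure_mono (Set.image_preimage_subset f A)
      (image_closure_subset_closure_image hf ⟨x, interior_subset hx, rfl⟩)
  have := interior_mono hsub hy
  rw [hA] at this
  exact this

theorem IsSkeletalMap.not_isNowhereDense_image (hf : IsSkeletalMap f) {U : Set X} (hU : IsOpen U)
    (hne : U.Nonempty) : ¬ IsNowhereDense (f '' U) := by
  intro h
  have h1 := hf _ h
  obtain ⟨x, hx⟩ := hne
  have : x ∈ interior (closure (f ⁻¹' (f '' U))) :=
    interior_maximal ((Set.subset_preimage_image f U).trans subset_closure) hU hx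
  rw [h1] at this
  exact this

/-- A finite image is closed, so not being nowhere dense gives it interior, and a nonempty finite
open set in a T1 space contains an isolated point. -/
theorem IsSkeletalMap.exists_isOpen_singleton [T1Space Y] (hf : IsSkeletalMap f) {U : Set X}
    (hU : IsOpen U) (hne : U.Nonempty) (hfin : (f '' U).Finite) : ∃ x ∈ U, IsOpen {f x} := by
  have h := hf.not_isNowhereDense_image hU hne
  rw [IsNowhereDense, hfin.isClosed.closure_eq, ← Ne, ← Set.nonempty_iff_ne_empty] at h
  obtain ⟨y, hy, hyo⟩ :=
    exists_isOpen_singleton_of_isOpen_finite (hfin.subset interior_subset) h isOpen_interior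
  obtain ⟨x, hx, rfl⟩ := interior_subset hy
  exact ⟨x, hx, hyo⟩

/-- A skeletal map of a compact second countable space is open at the points of a dense set. -/
theorem IsSkeletalMap.dense_setOf_nhds_le_map [CompactSpace X] [T2Space X]
    [SecondCountableTopology X] [T2Space Y] (hf : IsSkeletalMap f) (hc : Continuous f) :
    Dense {x | 𝓝 (f x) ≤ map f (𝓝 x)} := by
  -- Baire category: frontiers of the closed sets `f '' closure V` are nowhere dense, hence so are
  -- their preimages, and there are only countably many of them.
  have hd : Dense (⋂ V ∈ countableBasis X, (f ⁻¹' frontier (f '' closure V))ᶜ) := by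
    refine dense_biInter_of_isOpen (fun V _ => ?_) (countable_countableBasis X) fun V _ => ?_
    · exact (isClosed_frontier.preimage hc).isOpen_compl
    · have hcl : IsClosed (f '' closure V) := (isClosed_closure.isCompact.image hc).isClosed
      have h1 : IsNowhereDense (frontier (f '' closure V)) := by
        rw [IsNowhereDense, isClosed_frontier.closure_eq, interior_frontier hcl]
      have h2 := hf _ h1
      rw [IsNowhereDense, (isClosed_frontier.preimage hc).closure_eq] at h2
      exact interior_eq_empty_iff_dense_compl.mp h2
  refine hd.mono fun x hx W hW => ?_
  rw [mem_map] at hW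
  obtain ⟨K, ⟨hK, hKc⟩, hKW⟩ := (closed_nhds_basis x).mem_iff.mp hW
  obtain ⟨V, hV, hxV, hVK⟩ := (isBasis_countableBasis X).mem_nhds_iff.mp hK
  have hVW : closure V ⊆ f ⁻¹' W := (closure_minimal hVK hKc).trans hKW
  have hx' := Set.mem_iInter₂.mp hx V hV
  have hfx : f x ∈ f '' closure V := ⟨x, subset_closure hxV, rfl⟩
  have hint : f x ∈ interior (f '' closure V) := by
    by_contra hcon
    exact hx' ⟨subset_closure hfx, hcon⟩
  exact Filter.mem_of_superset (mem_interior_iff_mem_nhds.mp hint) (Set.image_subset_iff.mpr hVW)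

/-- Otherwise density puts all of `f '' U` in the finite set `f '' B`. Some `f x` with `x ∈ U` is
then isolated and equals some `f b` with `b ∈ B`, so injectivity over isolated points gives `x = b`,
against disjointness. -/
theorem IsSkeletalMap.exists_mem_notMem_image [T1Space Y]
    (hf : IsSkeletalMap f) (hc : Continuous f)
    (hiso : ∀ x x' : X, IsOpen {f x} → f x = f x' → x = x')
    {G : Set X} (hG : Dense G) {U : Set X} (hU : IsOpen U) (hne : U.Nonempty) {B : Set X}
    (hB : B.Finite) (hd : Disjoint U B) : ∃ x ∈ U, x ∈ G ∧ f x ∉ f '' B := by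
  by_contra! hcon
  have hcl : IsClosed (f ⁻¹' (f '' B)) := (hB.image f).isClosed.preimage hc
  have hsub : U ⊆ f ⁻¹' (f '' B) :=
    (hG.open_subset_closure_inter hU).trans (closure_minimal (fun x hx => hcon x hx.1 hx.2) hcl)
  obtain ⟨x, hx, hxo⟩ := hf.exists_isOpen_singleton hU hne
    ((hB.image f).subset (Set.image_subset_iff.mpr hsub))
  obtain ⟨b, hb, hbx⟩ := hsub hx
  have := hiso x b hxo hbx.symm
  subst this
  exact Set.disjoint_left.mp hd hx hb

/-- Points with distinct images can be chosen from a finite disjoint family of open sets. -/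
theorem IsSkeletalMap.exists_injective_choice [T1Space Y]
    (hf : IsSkeletalMap f) (hc : Continuous f)
    (hiso : ∀ x x' : X, IsOpen {f x} → f x = f x' → x = x')
    {G : Set X} (hG : Dense G) {ι : Type*} [Finite ι] {U : ι → Set X} (hU : ∀ i, IsOpen (U i))
    (hne : ∀ i, (U i).Nonempty) (hd : Pairwise (Function.onFun Disjoint U)) :
    ∃ g : ι → X, (∀ i, g i ∈ U i) ∧ (∀ i, g i ∈ G) ∧ Function.Injective (f ∘ g) := by
  classical
  have key : ∀ s : Set ι, s.Finite → ∃ g : ι → X, (∀ i ∈ s, g i ∈ U i) ∧ (∀ i ∈ s, g i ∈ G) ∧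
      Set.InjOn (f ∘ g) s := by
    intro s hs
    induction s, hs using Set.Finite.induction_on with
    | empty => exact ⟨fun i => (hne i).some, by simp⟩
    | @insert a s ha hs ih =>
      obtain ⟨g, hgU, hgG, hinj⟩ := ih
      obtain ⟨x, hxU, hxG, hx⟩ := hf.exists_mem_notMem_image hc hiso hG (hU a) (hne a)
        (hs.image g) (by
          rw [Set.disjoint_right]
          rintro _ ⟨i, hi, rfl⟩ h
          exact Set.disjoint_left.mp (hd fun h' : a = i => ha (h' ▸ hi)) h (hgU i hi))
      have hupd : ∀ i ∈ s, Function.update g a x i = g i := fun i hi =>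
        Function.update_of_ne (fun h : i = a => ha (h ▸ hi)) _ _
      refine ⟨Function.update g a x, ?_, ?_, ?_⟩
      · rintro i (rfl | hi)
        · simpa using hxU
        · rw [hupd i hi]; exact hgU i hi
      · rintro i (rfl | hi)
        · simpa using hxG
        · rw [hupd i hi]; exact hgG i hi
      · rw [Set.injOn_insert ha]
        refine ⟨fun i hi j hj hij => hinj hi hj ?_, ?_⟩
        · simpa only [Function.comp, hupd i hi, hupd j hj] using hij
        · rintro ⟨i, hi, hix⟩
          simp only [Function.comp, hupd i hi, Function.update_self] at hix
          exact hx ⟨g i, ⟨i, hi, rfl⟩, hix⟩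
  obtain ⟨g, h1, h2, h3⟩ := key Set.univ Set.finite_univ
  exact ⟨g, fun i => h1 i trivial, fun i => h2 i trivial, Set.injOn_univ.mp h3⟩

/-- A map that is open at the points of a finite set on which it is injective has a closed
subset that maps onto the target and meets their fibers only in those points. -/
theorem exists_isClosed_inter_fiber_eq_singleton [CompactSpace X] [T2Space X] [MetrizableSpace X]
    [T2Space Y] (hc : Continuous f) (hs : Function.Surjective f) {A : Set X} (hA : A.Finite)
    (hinj : Set.InjOn f A) (hopen : ∀ a ∈ A, 𝓝 (f a) ≤ map f (𝓝 a)) :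
    ∃ Z : Set X, IsClosed Z ∧ f '' Z = Set.univ ∧ A ⊆ Z ∧
      ∀ a ∈ A, ∀ z ∈ Z, f z = f a → z = a := by
  let := metrizableSpaceMetric X
  let d : X → ℝ := fun x => Metric.infDist x A
  have hdc : Continuous d := Metric.continuous_infDist_pt A
  -- The points nearest to `A` within their own fiber; compactness of fibers makes this set map onto
  -- `Y`.
  let Z : Set X := {x | ∀ x', f x' = f x → d x ≤ d x'}
  refine ⟨closure Z, isClosed_closure, ?_, fun a ha => ?_, fun a ha z hz hza => ?_⟩
  · refine Set.eq_univ_of_forall fun y => ?_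
    have hcomp : IsCompact (f ⁻¹' {y}) := (isClosed_singleton.preimage hc).isCompact
    obtain ⟨x, hx, hmin⟩ := hcomp.exists_isMinOn (hs y) hdc.continuousOn
    exact ⟨x, subset_closure fun x' hx' => hmin (hx'.trans hx), hx⟩
  · refine subset_closure fun x' _ => ?_
    simp only [d, Metric.infDist_zero_of_mem ha]
    exact Metric.infDist_nonneg
  -- Taking the closure adds nothing over `f a`: by openness at `a`, fibers near that of `a` meet
  -- `Metric.ball a ε`, so their minimizers satisfy `d ≤ ε`.
  · have hd0 : d z ≤ 0 := by
      refine le_of_forall_pos_le_add fun ε hε => ?_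
      rw [zero_add]
      have h1 : f '' Metric.ball a ε ∈ 𝓝 (f z) := by
        rw [hza]
        exact hopen a ha (Filter.image_mem_map (Metric.ball_mem_nhds a hε))
      have h2 : z ∈ closure (Z ∩ f ⁻¹' (f '' Metric.ball a ε)) :=
        mem_closure_iff_nhds.mpr fun t ht => by
          obtain ⟨w, hw, hwZ⟩ := mem_closure_iff_nhds.mp hz _
            (Filter.inter_mem ht (hc.continuousAt h1))
          exact ⟨w, hw.1, hwZ, hw.2⟩
      refine closure_minimal ?_ (isClosed_le hdc continuous_const) h2
      rintro w ⟨hwZ, x', hx', hfx'⟩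
      calc d w ≤ d x' := hwZ x' hfx'
        _ ≤ dist x' a := Metric.infDist_le_dist_of_mem ha
        _ ≤ ε := (Metric.mem_ball.mp hx').le
    have hzA : z ∈ A := (hA.isClosed.mem_iff_infDist_zero ⟨a, ha⟩).mpr
      (le_antisymm hd0 Metric.infDist_nonneg)
    exact hinj hzA ha hza

/-- Every compact Hausdorff space is the image of a compact totally disconnected one under a map
that sends no proper closed subset onto it. -/
theorem exists_irreducible_totallyDisconnected (X : Type u) [TopologicalSpace X] [CompactSpace X]
    [T2Space X] : ∃ (Z : Type u) (_ : TopologicalSpace Z) (h : Z → X), CompactSpace Z ∧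
      T2Space Z ∧ TotallyDisconnectedSpace Z ∧ Continuous h ∧ Function.Surjective h ∧
      ∀ E : Set Z, IsClosed E → h '' E = Set.univ → E = Set.univ := by
  -- The ultrafilters on the set `X` form a totally disconnected compactum over `X`; Zorn's lemma
  -- yields a minimal closed subset that still maps onto `X`.
  have hc : Continuous (Ultrafilter.extend (id : X → X)) := continuous_ultrafilter_extend id
  have hs : Function.Surjective (Ultrafilter.extend (id : X → X)) := fun x =>
    ⟨pure x, congrFun (ultrafilter_extend_extends id) x⟩
  obtain ⟨E, hE, hEs, hmin⟩ := exists_compact_surjective_zorn_subset hc hs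
  refine ⟨E, inferInstance, E.domRestrict (Ultrafilter.extend id), hE, inferInstance, inferInstance,
    hc.comp continuous_subtype_val, fun x => ?_, fun E₀ h0 h1 => ?_⟩
  · have : x ∈ Ultrafilter.extend id '' E := hEs ▸ Set.mem_univ x
    obtain ⟨e, he, hex⟩ := this
    exact ⟨⟨e, he⟩, hex⟩
  · by_contra h
    exact hmin E₀ h h0 h1

end Topology

/-! ### Limits of compacta and weight -/

theorem exists_preimage_subset_of_isLimit {J : Type u} [Category.{u} J] [IsCofiltered J]
    {S : J ⥤ CompHaus.{u}} {c : Cone S} (hc : IsLimit c) {U : Set c.pt} (hU : IsOpen U)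
    {x : c.pt} (hx : x ∈ U) :
    ∃ (j : J) (V : Set (S.obj j)), IsOpen V ∧ c.π.app j x ∈ V ∧ c.π.app j ⁻¹' V ⊆ U := by
  have hb := TopCat.isTopologicalBasis_cofiltered_limit.{u, u} (S ⋙ compHausToTop)
    (compHausToTop.mapCone c) (isLimitOfPreserves compHausToTop hc) (fun j => {V | IsOpen V})
    (fun j => isTopologicalBasis_opens) (fun j => isOpen_univ) (fun j U V => IsOpen.inter)
    (fun i j g V hV => hV.preimage (S.map g).hom.hom.continuous)
  obtain ⟨_, ⟨j, V, hV, rfl⟩, hxV, hVU⟩ := hb.exists_subset_of_mem_open hx hU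
  exact ⟨j, V, hV, hxV, hVU⟩

theorem topWeight_le_aleph0 (X : Type u) [TopologicalSpace X] [SecondCountableTopology X] :
    topWeight X ≤ Cardinal.aleph0 :=
  (csInf_le' (show _ ∈ {κ : Cardinal.{u} | ∃ B : Set (Set X),
    IsTopologicalBasis B ∧ Cardinal.mk B = κ} from ⟨countableBasis X, isBasis_countableBasis X, rfl⟩)).trans
    (Cardinal.le_aleph0_iff_set_countable.mpr (countable_countableBasis X))

theorem secondCountableTopology_of_topWeight_le {X : Type u} [TopologicalSpace X]
    (h : topWeight X ≤ Cardinal.aleph0) : SecondCountableTopology X := by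
  obtain ⟨B, hB, hBc⟩ := csInf_mem (s := {κ : Cardinal.{u} | ∃ B : Set (Set X),
    IsTopologicalBasis B ∧ Cardinal.mk B = κ}) ⟨_, _, isTopologicalBasis_opens, rfl⟩
  exact hB.secondCountableTopology (Cardinal.le_aleph0_iff_set_countable.mp (hBc.trans_le h))

theorem metrizableSpace_of_compact_secondCountable (X : Type*) [TopologicalSpace X]
    [CompactSpace X] [T2Space X] [SecondCountableTopology X] : MetrizableSpace X :=
  metrizableSpace_of_t3_secondCountable X

namespace CompFunctor

variable {F : CompHaus.{u} ⥤ CompHaus.{u}}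

/-- The embedding of a compactum into its sum with the Cantor set handles finite compacta. -/
theorem secondCountableTopology_obj (hm : Monomorphic F) (hw : WeightPreserving F)
    (X : CompHaus.{u}) [SecondCountableTopology X] : SecondCountableTopology (F.obj X) := by
  let C := ULift.{u} (ℕ → Bool)
  have : SecondCountableTopology C := Homeomorph.ulift.secondCountableTopology
  let Y : CompHaus.{u} := CompHaus.of (X ⊕ C)
  have : Infinite Y := inferInstanceAs (Infinite (X ⊕ C))
  have : SecondCountableTopology Y := inferInstanceAs (SecondCountableTopology (X ⊕ C))
  have : SecondCountableTopology (F.obj Y) :=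
    secondCountableTopology_of_topWeight_le ((hw Y inferInstance).trans (topWeight_le_aleph0 Y))
  let i : X ⟶ Y := CompHausLike.ofHom _ (⟨Sum.inl, continuous_inl⟩ : C(X, X ⊕ C))
  have hi : Function.Injective (F.map i) := hm i Sum.inl_injective
  exact ((F.map i).hom.hom.continuous.isClosedEmbedding hi).isEmbedding.secondCountableTopology

theorem metrizableSpace_obj (hm : Monomorphic F) (hw : WeightPreserving F)
    (X : CompHaus.{u}) [SecondCountableTopology X] : MetrizableSpace (F.obj X) :=
  have := secondCountableTopology_obj hm hw X
  metrizableSpace_of_compact_secondCountable _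

/-! ### Density of points with finite support -/

/-- Finer quotients are smaller in the order, so the directed index set is the order dual. -/
theorem ContinuousFunctor.preservesLimitsOfShape_discreteQuotient (hF : ContinuousFunctor F)
    (Z : Type u) [TopologicalSpace Z] : PreservesLimitsOfShape (DiscreteQuotient Z) F :=
  have := hF (DiscreteQuotient Z)ᵒᵈ
  preservesLimitsOfShape_of_equiv
    ((orderDualEquivalence (DiscreteQuotient Z)).op.trans (opOpEquivalence _)) F

/-- Every nonempty open subset of `FZ`, for zero-dimensional `Z`, contains an element supported by
any set of representatives of some finite clopen partition of `Z`. -/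
theorem ContinuousFunctor.exists_finite_section (hF : ContinuousFunctor F) (Z : Profinite.{u})
    {U : Set (F.obj (profiniteToCompHaus.obj Z))} (hU : IsOpen U) (hne : U.Nonempty) :
    ∃ (N : CompHaus.{u}) (_ : Finite N) (q : profiniteToCompHaus.obj Z ⟶ N),
      Function.Surjective q ∧ ∃ t : F.obj N, ∀ s : N ⟶ profiniteToCompHaus.obj Z,
        s ≫ q = 𝟙 N → F.map s t ∈ U := by
  have := hF.preservesLimitsOfShape_discreteQuotient Z
  have hlim := isLimitOfPreserves F (isLimitOfPreserves profiniteToCompHaus Z.asLimit)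
  obtain ⟨x, hx⟩ := hne
  obtain ⟨j, V, -, hxV, hVU⟩ := exists_preimage_subset_of_isLimit hlim hU hx
  let q : profiniteToCompHaus.obj Z ⟶ profiniteToCompHaus.obj (Z.diagram.obj j) :=
    profiniteToCompHaus.map (Z.asLimitCone.π.app j)
  refine ⟨_, inferInstanceAs (Finite j), q, j.proj_surjective, F.map q x, fun s hs => ?_⟩
  apply hVU
  change F.map q (F.map s (F.map q x)) ∈ V
  rw [← CategoryTheory.comp_apply, ← F.map_comp, hs, F.map_id]
  exact hxV

end CompFunctor

/-! ### Preservation of skeletal maps -/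

namespace CompFunctor

variable {F : CompHaus.{u} ⥤ CompHaus.{u}}

open Topology Filter

/-- The map is closed, so the complement of `f '' Uᶜ` is open; it lies in `f '' U` by surjectivity
and contains `f u` because the fiber through `u` misses `Uᶜ`. -/
theorem nonempty_interior_image_of_fiber {X Y : Type*} [TopologicalSpace X] [CompactSpace X]
    [TopologicalSpace Y] [T2Space Y] {f : X → Y} (hc : Continuous f)
    (hs : Function.Surjective f) {U : Set X} (hU : IsOpen U) {u : X} (hu : u ∈ U)
    (hfib : ∀ x, f x = f u → x = u) : (interior (f '' U)).Nonempty := by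
  have hcl : IsClosed (f '' Uᶜ) := (hU.isClosed_compl.isCompact.image hc).isClosed
  refine ⟨f u, interior_maximal ?_ hcl.isOpen_compl ?_⟩
  · intro y hy
    obtain ⟨x, rfl⟩ := hs y
    by_contra h
    exact hy ⟨x, fun hx => h ⟨x, hx, rfl⟩, rfl⟩
  · rintro ⟨x, hx, hxu⟩
    exact hx (hfib x hxu ▸ hu)

/-- A `1`-mecw functor preserves skeletality of surjective maps that are injective over isolated
points. -/
theorem IsOneMecw.isSkeletalMap_map (hF : IsOneMecw F) {X Y : CompHaus.{u}}
    [SecondCountableTopology X] [MetrizableSpace X] (f : X ⟶ Y) (hsurj : Function.Surjective f)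
    (hskel : IsSkeletalMap f) (hiso : ∀ x x' : X, IsOpen {f x} → f x = f x' → x = x') :
    IsSkeletalMap (F.map f) := by
  have hfc : Continuous f := f.hom.hom.continuous
  refine isSkeletalMap_of_nonempty_interior_image (F.map f).hom.hom.continuous fun U hU hUne => ?_
  obtain ⟨Z, _, h, _, _, _, hhc, hhs, hirr⟩ := exists_irreducible_totallyDisconnected X
  let ZP : Profinite.{u} := Profinite.of Z
  let hh : profiniteToCompHaus.obj ZP ⟶ X := CompHausLike.ofHom _ (⟨h, hhc⟩ : C(Z, X))
  have hV : (F.map hh ⁻¹' U).Nonempty := hUne.preimage (hF.epimorphic hh hhs)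
  obtain ⟨N, _, q, hq, t, ht⟩ := hF.continuous.exists_finite_section ZP
    (hU.preimage (F.map hh).hom.hom.continuous) hV
  have : T1Space N := T2Space.t1Space
  have : T1Space Y := T2Space.t1Space
  have : DiscreteTopology N := Finite.instDiscreteTopology
  have hqc : Continuous q := q.hom.hom.continuous
  -- `O k` consists of the points whose whole `h`-fiber lies in the block `k` of the partition;
  -- irreducibility of `h` makes it nonempty. Any lifts of points `g k ∈ O k` to `Z` therefore form
  -- a section of `q`.
  let O : N → Set X := fun k => (h '' (q ⁻¹' {k})ᶜ)ᶜ
  have hO : ∀ k, IsOpen (O k) := fun k =>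
    (((isOpen_discrete _).preimage hqc).isClosed_compl.isCompact.image hhc).isClosed.isOpen_compl
  have hOne : ∀ k, (O k).Nonempty := fun k => by
    by_contra hcon
    have h1 := hirr (q ⁻¹' {k})ᶜ ((isOpen_discrete _).preimage hqc).isClosed_compl
      (Set.compl_empty_iff.mp (Set.not_nonempty_iff_eq_empty.mp hcon))
    obtain ⟨z, hz⟩ := hq k
    exact (h1 ▸ Set.mem_univ z : z ∈ (q ⁻¹' {k})ᶜ) hz
  have hOq : ∀ k z, h z ∈ O k → q z = k := fun k z hz => by
    by_contra hcon
    exact hz ⟨z, hcon, rfl⟩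
  have hOd : Pairwise (Function.onFun Disjoint O) := fun k l hkl => Set.disjoint_left.mpr
    fun x hxk hxl => by
      obtain ⟨z, rfl⟩ := hhs x
      exact hkl ((hOq k z hxk).symm.trans (hOq l z hxl))
  obtain ⟨g, hgO, hgG, hginj⟩ := hskel.exists_injective_choice hfc hiso
    (hskel.dense_setOf_nhds_le_map hfc) hO hOne hOd
  choose s hs using fun k => hhs (g k)
  let s' : N ⟶ profiniteToCompHaus.obj ZP :=
    CompHausLike.ofHom _ (⟨s, continuous_of_discreteTopology⟩ : C(N, Z))
  have hs' : F.map (s' ≫ hh) t ∈ U := by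
    have h1 := ht s' (by
      ext k
      exact hOq k (s k) (by rw [hs]; exact hgO k))
    rw [F.map_comp, CategoryTheory.comp_apply]
    exact h1
  obtain ⟨T, hTc, hTs, hgT, hTf⟩ := exists_isClosed_inter_fiber_eq_singleton hfc hsurj
    (Set.finite_range g) (by
      rintro _ ⟨k, rfl⟩ _ ⟨l, rfl⟩ hkl
      rw [hginj hkl])
    (by rintro _ ⟨k, rfl⟩; exact hgG k)
  let T' : Closeds X := ⟨T, hTc⟩
  have hTcomp : CompactSpace (T' : Set X) := isCompact_iff_compactSpace.mp hTc.isCompact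
  let g' : N ⟶ closedSub T' := CompHausLike.ofHom _
    (⟨fun k => ⟨g k, hgT ⟨k, rfl⟩⟩, continuous_of_discreteTopology⟩ :
      C(N, (T' : Set X)))
  obtain ⟨p, hp⟩ : ∃ p : closedSub T' ⟶ Y, p = closedIncl T' ≫ f := ⟨_, rfl⟩
  have hps : Function.Surjective p := fun y => by
    obtain ⟨x, hx, hxy⟩ := hTs.symm ▸ Set.mem_univ y
    exact hp ▸ ⟨⟨x, hx⟩, hxy⟩
  have hgi : g' ≫ closedIncl T' = s' ≫ hh := by
    ext k
    exact (hs k).symm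
  -- Bicommutativity says that the fiber of `p` over the image of each `g k` is a single point,
  -- which is what `T` was chosen for.
  have hbi : Bicommutative g' (𝟙 N) p (g' ≫ p) := by
    refine ⟨⟨by simp⟩, fun k => ?_⟩
    ext z
    constructor
    · rintro ⟨l, rfl, rfl⟩
      rfl
    · intro hz
      subst hp
      exact ⟨k, rfl, Subtype.ext (hTf (g k) ⟨k, rfl⟩ z.1 z.2 hz).symm⟩
  have hg'inj : Function.Injective (g' ≫ p) := hp ▸ hginj
  have hFb := hF.finiteOnePreimages g' (𝟙 N) p (g' ≫ p) inferInstance hg'inj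
    (fun k l hkl => hg'inj (congrArg p hkl)) Function.bijective_id hbi
  have hfib : ∀ w, F.map p w = F.map p (F.map g' t) → w = F.map g' t := fun w hw => by
    have h1 : w ∈ F.map p ⁻¹' {F.map (g' ≫ p) t} := by
      rw [F.map_comp, CategoryTheory.comp_apply]
      exact hw
    rw [← hFb.image_fiber t] at h1
    obtain ⟨t', ht', rfl⟩ := h1
    rw [F.map_id] at ht'
    rw [show t' = t from ht']
  have hmem : F.map (closedIncl T') (F.map g' t) ∈ U := by
    rw [← CategoryTheory.comp_apply, ← F.map_comp, hgi]
    exact hs'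
  obtain ⟨y, hy⟩ := nonempty_interior_image_of_fiber (F.map p).hom.hom.continuous
    (hF.epimorphic p hps) (hU.preimage (F.map (closedIncl T')).hom.hom.continuous) hmem hfib
  refine ⟨y, interior_mono ?_ hy⟩
  rintro _ ⟨w, hw, rfl⟩
  refine ⟨_, hw, ?_⟩
  rw [hp, F.map_comp]
  rfl

theorem IsNormal.isOneMecw (hF : IsNormal F) : IsOneMecw F where
  monomorphic := hF.monomorphic
  epimorphic := hF.epimorphic
  continuous := hF.continuous
  finiteOnePreimages _ _ _ _ f' pX pY f _ hf hf' _ hb := hF.preimages f' pX pY f hf hf' hb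
  weight := hF.weight

end CompFunctor

/-! ### Countable sets closed under a countably-valued operation -/

/-- The countable subsets that contain `a₀` and are closed under the set-valued operation `φ`,
ordered by inclusion. -/
abbrev CountableClosedSets {I : Type u} (φ : I → I → Set I) (a₀ : I) : Type u :=
  {D : Set I // D.Countable ∧ a₀ ∈ D ∧ ∀ a ∈ D, ∀ b ∈ D, φ a b ⊆ D}

namespace CountableClosedSets

variable {I : Type u} {φ : I → I → Set I} {a₀ : I}

/-- Closing off under `φ` takes `ω` steps, each adding countably many indices. -/
theorem exists_isLeast (hφ : ∀ a b, (φ a b).Countable) {E : Set I} (hE : E.Countable) :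
    ∃ D : CountableClosedSets φ a₀, IsLeast {D : CountableClosedSets φ a₀ | E ⊆ D.1} D := by
  let step : Set I → Set I := fun D => D ∪ ⋃ a ∈ D, ⋃ b ∈ D, φ a b
  let D : ℕ → Set I := fun n => step^[n] (insert a₀ E)
  have hsucc : ∀ n, D (n + 1) = step (D n) := fun n => Function.iterate_succ_apply' _ _ _
  have hmono : Monotone D := monotone_nat_of_le_succ fun n => by
    rw [hsucc]; exact Set.subset_union_left
  have hc : ∀ n, (D n).Countable := fun n => by
    induction n with
    | zero => exact hE.insert a₀
    | succ n ih =>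
      rw [hsucc]
      exact ih.union (ih.biUnion fun a _ => ih.biUnion fun b _ => hφ a b)
  refine ⟨⟨⋃ n, D n, Set.countable_iUnion hc, Set.mem_iUnion.mpr ⟨0, Set.mem_insert _ _⟩, ?_⟩,
    ?_, ?_⟩
  · intro a ha b hb
    obtain ⟨m, hm⟩ := Set.mem_iUnion.mp ha
    obtain ⟨n, hn⟩ := Set.mem_iUnion.mp hb
    refine Set.Subset.trans ?_ (Set.subset_iUnion D (max m n + 1))
    rw [hsucc]
    exact fun x hx => Or.inr (Set.mem_biUnion (hmono (le_max_left m n) hm)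
      (Set.mem_biUnion (hmono (le_max_right m n) hn) hx))
  · exact (Set.subset_insert _ _).trans (Set.subset_iUnion D 0)
  · rintro D' hD'
    refine Set.iUnion_subset fun n => ?_
    induction n with
    | zero => exact Set.insert_subset D'.2.2.1 hD'
    | succ n ih =>
      rw [hsucc]
      exact Set.union_subset ih (Set.iUnion₂_subset fun a ha => Set.iUnion₂_subset fun b hb =>
        D'.2.2.2 a (ih ha) b (ih hb))

theorem exists_isLUB (hφ : ∀ a b, (φ a b).Countable) {T : Set (CountableClosedSets φ a₀)}
    (hT : T.Countable) : ∃ D, IsLUB T D := by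
  obtain ⟨D, hD, hmin⟩ := exists_isLeast (a₀ := a₀) hφ (hT.biUnion fun D _ => D.2.1)
  exact ⟨D, fun D' hD' => (Set.subset_biUnion_of_mem hD').trans hD,
    fun D' hD' => hmin (Set.iUnion₂_subset fun D'' h => hD' h)⟩

theorem isDirectedOrder (hφ : ∀ a b, (φ a b).Countable) :
    IsDirectedOrder (CountableClosedSets φ a₀) where
  directed D D' := by
    obtain ⟨E, hE⟩ := exists_isLUB hφ (Set.toFinite {D, D'}).countable
    exact ⟨E, hE.1 (Set.mem_insert _ _), hE.1 (Set.mem_insert_of_mem _ rfl)⟩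

/-- The union of a countable directed family is already closed, since any two of its elements lie in
a common member; the supremum is thus no larger than the union. -/
theorem exists_mem_of_isLUB {T : Set (CountableClosedSets φ a₀)} (hT : T.Countable)
    (hne : T.Nonempty) (hdir : DirectedOn (· ≤ ·) T) {D : CountableClosedSets φ a₀}
    (hD : IsLUB T D) {a : I} (ha : a ∈ D.1) : ∃ D' ∈ T, a ∈ D'.1 := by
  let U : CountableClosedSets φ a₀ := ⟨⋃ D ∈ T, D.1, hT.biUnion fun D _ => D.2.1,
    Set.mem_biUnion hne.some_mem hne.some.2.2.1, fun a ha b hb => by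
      obtain ⟨D₁, h₁, ha⟩ := Set.mem_iUnion₂.mp ha
      obtain ⟨D₂, h₂, hb⟩ := Set.mem_iUnion₂.mp hb
      obtain ⟨D₃, h₃, h₁₃, h₂₃⟩ := hdir D₁ h₁ D₂ h₂
      exact (D₃.2.2.2 a (h₁₃ ha) b (h₂₃ hb)).trans (Set.subset_biUnion_of_mem h₃)⟩
  have h : D ≤ U := hD.2 fun D' hD' => Set.subset_biUnion_of_mem (u := Subtype.val) hD'
  simpa only [U, Set.mem_iUnion, exists_prop] using h ha

end CountableClosedSets

/-! ### Spectra -/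

namespace InverseSpectrum

variable {I : Type u} [PartialOrder I] {S : Iᵒᵖ ⥤ CompHaus.{u}}

theorem bond_bond {α β γ : I} (h : α ≤ β) (h' : β ≤ γ) (x : S.obj (op γ)) :
    bond S h (bond S h' x) = bond S (h.trans h') x := by
  rw [← CategoryTheory.comp_apply, bond, bond, ← S.map_comp]
  rfl

/-- The fiber over `y ∈ X_α` in `X_β` has more than one point. -/
def Splits (S : Iᵒᵖ ⥤ CompHaus.{u}) (α : I) (y : S.obj (op α)) (β : I) : Prop :=
  ∃ (h : α ≤ β) (x x' : S.obj (op β)), x ≠ x' ∧ bond S h x = y ∧ bond S h x' = y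

/-- Isolated points at the supremum of a directed set closed under splitting isolated points have
one-point fibers. -/
theorem IsOmegaSpectrum.eq_of_bond_eq (hS : IsOmegaSpectrum S)
    (hs : ∀ (α β : I) (h : α ≤ β), Function.Surjective (bond S h)) {D : Set I} (hD : D.Countable)
    (hne : D.Nonempty) (hdir : DirectedOn (· ≤ ·) D)
    (hsplit : ∀ α ∈ D, ∀ y : S.obj (op α), IsOpen {y} → (∃ β, Splits S α y β) →
      ∃ β ∈ D, Splits S α y β)
    {γ δ : I} (hγ : IsLUB D γ) (h : γ ≤ δ) {x x' : S.obj (op δ)} (hx : IsOpen {bond S h x})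
    (hxx' : bond S h x = bond S h x') : x = x' := by
  by_contra hcon
  obtain ⟨hlim⟩ := hS.omega_continuous D γ hD hne hdir hγ
  have := hne.to_subtype
  have : IsDirectedOrder D := directedOn_iff_isDirectedOrder.mp hdir
  -- The isolated point of `X_γ` is determined at some stage `α ∈ D`, where it projects to an
  -- isolated point. If that point split above `γ`, it would split within `D`, and `X_γ` would have
  -- two points over it.
  obtain ⟨j, V, hV, hxV, hVx⟩ := exists_preimage_subset_of_isLimit hlim hx
    (Set.mem_singleton (bond S h x))
  obtain ⟨⟨α, hα⟩⟩ := j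
  have hVx' : ∀ w, bond S (hγ.1 hα) w ∈ V → w = bond S h x := fun w hw => hVx hw
  have hopen : IsOpen {bond S (hγ.1 hα) (bond S h x)} := by
    have hV' : V = {bond S (hγ.1 hα) (bond S h x)} :=
      Set.eq_singleton_iff_unique_mem.mpr ⟨hxV, fun v hv => by
        obtain ⟨w, rfl⟩ := hs _ _ (hγ.1 hα) v
        rw [hVx' w hv]⟩
    exact hV' ▸ hV
  obtain ⟨β, hβ, hαβ, p, p', hpp', hp, hp'⟩ := hsplit α hα _ hopen
    ⟨δ, (hγ.1 hα).trans h, x, x', hcon, (bond_bond _ _ _).symm,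
      by rw [hxx', bond_bond]⟩
  obtain ⟨w, rfl⟩ := hs _ _ (hγ.1 hβ) p
  obtain ⟨w', rfl⟩ := hs _ _ (hγ.1 hβ) p'
  rw [bond_bond] at hp hp'
  refine hpp' ?_
  rw [hVx' w (hp ▸ hxV), hVx' w' (hp' ▸ hxV)]

theorem countable_setOf_isOpen_singleton (X : Type*) [TopologicalSpace X]
    [SecondCountableTopology X] : {y : X | IsOpen {y}}.Countable :=
  Set.PairwiseDisjoint.countable_of_isOpen (s := fun y : X => {y})
    (fun _ _ _ _ hxy => Set.disjoint_singleton.mpr hxy) (fun _ hy => hy)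
    fun y _ => Set.singleton_nonempty y

/-- A monotone map carries the limit property at a supremum back to its source. -/
theorem nonempty_isLimit_coneAt_comp (S : Iᵒᵖ ⥤ CompHaus.{u}) {J : Type u} [PartialOrder J]
    {G : J → I} (hG : Monotone G) {T : Set J} (hdir : DirectedOn (· ≤ ·) T) {γ : J}
    (hγ : γ ∈ upperBounds T) (hγ' : G γ ∈ upperBounds (G '' T))
    (h : IsLimit (coneAt S (G '' T) hγ')) :
    Nonempty (IsLimit (coneAt (hG.functor.op ⋙ S) T hγ)) := by
  have : IsDirectedOrder T := directedOn_iff_isDirectedOrder.mp hdir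
  let r : T → G '' T := fun t => ⟨G t, t, t.2, rfl⟩
  have hr : Monotone r := fun s t hst => hG hst
  have : hr.functor.Final := hr.final_functor_iff.mpr (by
    rintro ⟨_, t, ht, rfl⟩
    exact ⟨⟨t, ht⟩, le_rfl⟩)
  exact ⟨(Functor.Initial.isLimitWhiskerEquiv hr.functor.op _).symm h⟩

end InverseSpectrum

/-! ### Reindexing the spectrum and applying the functor -/

open InverseSpectrum

theorem CompFunctor.IsOneMecw.skeletallyGenerated_obj {F : CompHaus.{u} ⥤ CompHaus.{u}}
    (hF : IsOneMecw F) {X : CompHaus.{u}} (hX : SkeletallyGenerated X) :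
    SkeletallyGenerated (F.obj X) := by
  obtain ⟨I, _, S, c, hS, hmet, hbond, ⟨hc⟩, ⟨e⟩⟩ := hX
  have hsc := hS.countable_weight
  have hsurj : ∀ (α β : I) (h : α ≤ β), Function.Surjective (bond S h) :=
    fun α β h => (hbond α β h).1
  obtain ⟨a₀, -⟩ := hS.omega_complete ∅ Set.countable_empty
  have hsp : ∀ (α : I) (y : S.obj (op α)), ∃ β, (∃ β', Splits S α y β') → Splits S α y β :=
    fun α y => by
      by_cases h : ∃ β', Splits S α y β'
      · exact h.imp fun _ h' _ => h'
      · exact ⟨α, fun h' => (h h').elim⟩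
  choose split hsplit using hsp
  -- Least upper bounds make closed sets directed; the second part adds, for each of the countably
  -- many isolated points of `X_a`, a stage where it splits, if there is one.
  let φ : I → I → Set I := fun a b => {c | IsLUB {a, b} c} ∪ split a '' {y | IsOpen {y}}
  have hφ : ∀ a b, (φ a b).Countable := fun a b =>
    (Set.Subsingleton.countable fun c hc c' hc' => hc.unique hc').union
      ((countable_setOf_isOpen_singleton _).image _)
  let J := CountableClosedSets φ a₀
  have : IsDirectedOrder J := CountableClosedSets.isDirectedOrder hφ
  have : Nonempty J := ⟨(CountableClosedSets.exists_isLeast hφ Set.countable_empty).choose⟩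
  choose G hG using fun D : J => hS.omega_complete D.1 D.2.1
  have hGm : Monotone G := fun D D' h => (hG D).2 fun a ha => (hG D').1 (h ha)
  have hDdir : ∀ D : J, DirectedOn (· ≤ ·) D.1 := fun D a ha b hb => by
    obtain ⟨c, hc⟩ := hS.omega_complete {a, b} (Set.toFinite _).countable
    exact ⟨c, D.2.2.2 a ha b hb (Or.inl hc), hc.1 (Set.mem_insert _ _),
      hc.1 (Set.mem_insert_of_mem _ rfl)⟩
  have hfib : ∀ (D D' : J) (h : D ≤ D') (x x' : S.obj (op (G D'))),
      IsOpen {bond S (hGm h) x} → bond S (hGm h) x = bond S (hGm h) x' → x = x' :=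
    fun D D' h x x' => hS.eq_of_bond_eq hsurj D.2.1 ⟨a₀, D.2.2.1⟩ (hDdir D)
      (fun α hα y hy hβ => ⟨split α y, D.2.2.2 α hα α hα (Or.inr ⟨y, hy, rfl⟩), hsplit α y hβ⟩)
      (hG D) (hGm h)
  -- Every index belongs to some closed set, so passing to the suprema `G D` does not change the
  -- limit.
  have hcofinal : hGm.functor.Final := hGm.final_functor_iff.mpr fun a => by
    obtain ⟨D, hD, -⟩ := CountableClosedSets.exists_isLeast (a₀ := a₀) hφ (Set.countable_singleton a)
    exact ⟨D, (hG D).1 (hD rfl)⟩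
  refine ⟨J, inferInstance, (hGm.functor.op ⋙ S) ⋙ F, F.mapCone (c.whisker hGm.functor.op),
    ⟨fun D => ?_, fun T hT => CountableClosedSets.exists_isLUB hφ hT, ?_⟩, fun D => ?_,
    fun D D' h => ⟨?_, ?_⟩, ?_, ?_⟩
  · exact secondCountableTopology_obj hF.monomorphic hF.weight (S.obj (op (G D)))
  · intro T γ hT hne hdir hγ
    have hlub : IsLUB (G '' T) (G γ) := by
      refine ⟨hGm.mem_upperBounds_image hγ.1, fun b hb => (hG γ).2 fun a ha => ?_⟩
      obtain ⟨D, hD, haD⟩ := CountableClosedSets.exists_mem_of_isLUB hT hne hdir hγ ha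
      exact ((hG D).1 haD).trans (hb ⟨D, hD, rfl⟩)
    obtain ⟨h1⟩ := hS.omega_continuous (G '' T) (G γ) (hT.image G) (hne.image G)
      (hdir.mono_comp hGm) hlub
    obtain ⟨h2⟩ := nonempty_isLimit_coneAt_comp S hGm hdir hγ.1 hlub.1 h1
    have := hne.to_subtype
    have : IsDirectedOrder T := directedOn_iff_isDirectedOrder.mp hdir
    have := hF.continuous T
    exact ⟨isLimitOfPreserves F h2⟩
  · exact metrizableSpace_obj hF.monomorphic hF.weight (S.obj (op (G D)))
  · exact hF.epimorphic (bond S (hGm h)) (hsurj _ _ _)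
  · exact hF.isSkeletalMap_map (bond S (hGm h)) (hsurj _ _ _) (hbond _ _ _).2 (hfib D D' h)
  · have := hF.continuous J
    exact ⟨isLimitOfPreserves F ((Functor.Initial.isLimitWhiskerEquiv hGm.functor.op c).symm hc)⟩
  · exact ⟨CompHausLike.homeoOfIso (F.mapIso (CompHausLike.isoOfHomeo e))⟩

theorem theorem1p6 :
    (∀ F : CompHaus.{u} ⥤ CompHaus.{u}, CompFunctor.IsOneMecw F →
      ∀ X : CompHaus.{u}, SkeletallyGenerated X → SkeletallyGenerated (F.obj X)) ∧
    (∀ F : CompHaus.{u} ⥤ CompHaus.{u}, CompFunctor.IsNormal F → CompFunctor.IsOneMecw F) :=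
  ⟨fun _ hF _ hX => hF.skeletallyGenerated_obj hX, fun _ hF => hF.isOneMecw⟩
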